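/- Let $\alpha\in(0,1)$ be irrational, let $R(x)=x+\alpha \pmod 1$ be the rotation by $\alpha$ on $[0,1)$, let $f(x)=1/x$, and let $S_N(f)(x)=\sum_{n=0}^{N-1} f(R^n x)$. Let $\lambda$ be the Lebesgue measure on $[0,1)$ and let $(q_n)$ be the denominators of the continued fraction convergents of $\alpha$. Call $\alpha$ of Roth type if for every $\epsilon>0$ we have $q_{n+1}<q_n^{1+\epsilon}$ for all sufficiently large $n$ (equivalently, $\log q_{n+1}/\log q_n\to 1$). There is a sequence $d_N>0$ $(N\ge 1)$ such that $$\lambda\left(\left|\frac{S_N(f)}{d_N}-1\right|>\epsilon\right)\to 0\quad (N\to\infty)\qquad\text{for all }\epsilon>0 \tag{1}$$ if and only if $\alpha$ is of Roth type. Furthermore, if $\alpha$ is of Roth type, then (1) holds with $d_N=N\log N$, and every sequence $d_N>0$ for which (1) holds satisfies $d_N/(N\log N)\to 1$. -/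

import Mathlib

open Filter Topology MeasureTheory

noncomputable section

namespace RotationWeakLaw

/-- The rotation `x ↦ x + α (mod 1)`, with the circle identified with `[0, 1)`. -/
def rotation (α x : ℝ) : ℝ := Int.fract (x + α)

/-- The observable `f(x) = 1 / x`. Its value at the singularity `0` (here `0`, rather than `∞`)
is hit by `S_N(f)` only for finitely many `x`, so it does not affect the measures below. -/
def observable (x : ℝ) : ℝ := 1 / x

/-- The ergodic sum `S_N(f)(x) = ∑_{n < N} f (R^n x)` of `f(x) = 1 / x` over the rotation. -/
def ergodicSum (α : ℝ) (N : ℕ) (x : ℝ) : ℝ := birkhoffSum (rotation α) observable N x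

/-- The untrimmed weak law with normalising sequence `d`:
`λ(|S_N(f) / d_N - 1| > ε) → 0` for all `ε > 0`, with `λ` the Lebesgue measure on `[0, 1)`. -/
def WeakLaw (α : ℝ) (d : ℕ → ℝ) : Prop :=
  ∀ ε : ℝ, 0 < ε →
    Tendsto
      (fun N : ℕ => volume {x : ℝ | x ∈ Set.Ico (0 : ℝ) 1 ∧ ε < |ergodicSum α N x / d N - 1|})
      atTop (𝓝 0)

/-- `α` is of Roth type: `q_{n+1} < q_n ^ (1 + ε)` for every `ε > 0` and all large `n`, where
`q_n` are the denominators of the continued fraction convergents of `α`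
(here `q_0 = 1`, `q_1 = a_1`, and `q_{n+1} = a_{n+1} q_n + q_{n-1}`). -/
def IsRothType (α : ℝ) : Prop :=
  ∀ ε : ℝ, 0 < ε →
    ∀ᶠ n : ℕ in atTop,
      (GenContFract.of α).dens (n + 1) < (GenContFract.of α).dens n ^ (1 + ε)

end RotationWeakLaw

end

namespace RotationWeakLaw

/-! Suppose `α` is of Roth type. Then near every large `N`, on the logarithmic scale, there is a
convergent denominator `q`. Split `1 / x` at `θ = N ^ (3δ - 1)`. Capped at height `1 / θ` it is
monotone and bounded, so a Denjoy–Koksma bound on blocks of length `q` (`abs_sum_orbit_sub_le`)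
gives `N log N` up to a relative error `4δ`, uniformly in `x`. The excess on `[η / N, θ)` has mean
at most `4δ N log N` and is handled by Markov's inequality; a visit below `η / N` has probability at
most `η`.

Otherwise `r = |q α - p| ≤ q ^ (-1 - ε)` for arbitrarily large `q`. For `N = 2 M q` with `N r` at
most a small constant `c`, the orbit consists of `q` clusters, each a progression of `2 M` points
with step `r`. On at least half of the circle the sum is `O(N log q)` (`measure_sum_gt_le`). On a
set of measure at least `c / 4` a cluster straddles `0` and contributes a harmonic sum of order
`(log M) / r` (`le_sum_of_center_visit`), larger by a fixed factor once `c` is small against `ε`. No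
single `d N` fits both sets.

Two valid normalisations are compared at one point that is typical for both (`WeakLaw.tendsto_div`).
-/

/-! ### Continued fractions and the Roth condition -/

theorem exists_int_contsAux (v : ℝ) (n : ℕ) :
    ∃ a b : ℤ, (GenContFract.of v).contsAux n = ⟨(a : ℝ), (b : ℝ)⟩ := by
  induction n using Nat.strong_induction_on with
  | _ n ih =>
    match n with
    | 0 => exact ⟨1, 0, by simp [GenContFract.contsAux]⟩
    | 1 => exact ⟨⌊v⌋, 1, by simp [GenContFract.contsAux]⟩
    | n + 2 =>
      obtain ⟨a, b, h⟩ := ih n (by omega)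
      obtain ⟨a', b', h'⟩ := ih (n + 1) (by omega)
      cases hs : (GenContFract.of v).s.get? n with
      | none =>
        exact ⟨a', b', by rw [GenContFract.contsAux, hs, h']⟩
      | some gp =>
        obtain ⟨h1, z, hz⟩ := GenContFract.of_partNum_eq_one_and_exists_int_partDen_eq hs
        refine ⟨z * a' + a, z * b' + b, ?_⟩
        rw [GenContFract.contsAux_recurrence hs h h', h1, hz]
        push_cast
        simp

theorem not_terminatedAt_of_irrational {α : ℝ} (hα : Irrational α) (n : ℕ) :
    ¬ (GenContFract.of α).TerminatedAt n := fun h =>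
  have ⟨q, hq⟩ := (GenContFract.terminates_iff_rat α).1 ⟨n, h⟩
  hα ⟨q, hq.symm⟩

theorem fib_le_dens {α : ℝ} (hα : Irrational α) (n : ℕ) :
    (Nat.fib (n + 1) : ℝ) ≤ (GenContFract.of α).dens n :=
  GenContFract.succ_nth_fib_le_of_nth_den (Or.inr (not_terminatedAt_of_irrational hα _))

theorem tendsto_dens {α : ℝ} (hα : Irrational α) :
    Tendsto (GenContFract.of α).dens atTop atTop := by
  refine tendsto_atTop_mono (fun n => fib_le_dens hα n) ?_
  refine tendsto_natCast_atTop_atTop.comp ?_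
  exact (Nat.fib_add_two_strictMono.tendsto_atTop).comp (tendsto_sub_atTop_nat 1) |>.congr' (by
    filter_upwards [eventually_ge_atTop 1] with n hn
    obtain ⟨m, rfl⟩ := Nat.exists_eq_add_of_le' hn
    simp)

/-- The convergents are reduced fractions that approximate `α` to within `1 / (q_n q_{n+1})`. -/
theorem exists_convergent {α : ℝ} (hα : Irrational α) (n : ℕ) :
    ∃ (p : ℤ) (q : ℕ), 0 < q ∧ IsCoprime p (q : ℤ) ∧ (q : ℝ) = (GenContFract.of α).dens n ∧
      |q * α - p| ≤ 1 / (GenContFract.of α).dens (n + 1) := by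
  obtain ⟨a, b, h⟩ := exists_int_contsAux α (n + 1)
  obtain ⟨a', b', h'⟩ := exists_int_contsAux α (n + 2)
  have hA : (GenContFract.of α).nums n = a := by
    rw [GenContFract.num_eq_conts_a, GenContFract.nth_cont_eq_succ_nth_contAux, h]
  have hB : (GenContFract.of α).dens n = b := by
    rw [GenContFract.den_eq_conts_b, GenContFract.nth_cont_eq_succ_nth_contAux, h]
  have hA' : (GenContFract.of α).nums (n + 1) = a' := by
    rw [GenContFract.num_eq_conts_a, GenContFract.nth_cont_eq_succ_nth_contAux, h']
  have hB' : (GenContFract.of α).dens (n + 1) = b' := by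
    rw [GenContFract.den_eq_conts_b, GenContFract.nth_cont_eq_succ_nth_contAux, h']
  have hpos : (0 : ℝ) < (GenContFract.of α).dens n :=
    lt_of_lt_of_le (by exact_mod_cast Nat.fib_pos.2 (Nat.succ_pos n)) (fib_le_dens hα n)
  have hpos' : (0 : ℝ) < (GenContFract.of α).dens (n + 1) :=
    lt_of_lt_of_le (by exact_mod_cast Nat.fib_pos.2 (Nat.succ_pos _)) (fib_le_dens hα _)
  have hb : 0 < b := by rw [hB] at hpos; exact_mod_cast hpos
  -- Consecutive convergents have determinant `±1`; multiplied by its sign, this is a Bézout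
  -- identity for `a` and `b`.
  have hdet : (a : ℝ) * b' - b * a' = (-1) ^ (n + 1) := by
    have := (SimpContFract.of α).determinant (n := n) (not_terminatedAt_of_irrational hα n)
    have e : (↑(SimpContFract.of α) : GenContFract ℝ) = GenContFract.of α := rfl
    rwa [e, hA, hB, hA', hB'] at this
  have hdet' : a * b' - b * a' = (-1) ^ (n + 1) := by exact_mod_cast hdet
  lift b to ℕ using hb.le
  refine ⟨a, b, by exact_mod_cast hb, ?_, by simpa using hB.symm, ?_⟩
  · refine ⟨b' * (-1) ^ (n + 1), -a' * (-1) ^ (n + 1), ?_⟩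
    have : ((-1 : ℤ) ^ (n + 1)) * (-1) ^ (n + 1) = 1 := by
      rw [← mul_pow]; simp
    linear_combination ((-1 : ℤ) ^ (n + 1)) * hdet' + this
  · have happ := GenContFract.abs_sub_convs_le (v := α) (not_terminatedAt_of_irrational hα n)
    rw [GenContFract.conv_eq_num_div_den, hA, hB] at happ
    rw [hB] at hpos
    have : (((b : ℕ) : ℤ) : ℝ) * α - a = b * (α - a / ((b : ℤ) : ℝ)) := by
      push_cast at hpos ⊢
      field_simp
    push_cast at this happ hpos ⊢
    rw [this, abs_mul, abs_of_pos hpos]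
    calc _ ≤ (b : ℝ) * (1 / (b * (GenContFract.of α).dens (n + 1))) := by gcongr
      _ = _ := by field_simp

/-- For `α` of Roth type, every window `[N ^ (1 - 2δ), N ^ (1 - δ)]` with `N` large contains the
denominator of a convergent. -/
theorem IsRothType.exists_convergent_mem {α : ℝ} (hα : Irrational α) (h : IsRothType α) {δ : ℝ}
    (hδ : 0 < δ) (hδ1 : δ < 1 / 2) :
    ∀ᶠ N : ℕ in atTop, ∃ (p : ℤ) (q : ℕ), 0 < q ∧ IsCoprime p (q : ℤ) ∧ |q * α - p| ≤ 1 / q ∧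
      (N : ℝ) ^ (1 - 2 * δ) ≤ q ∧ (q : ℝ) ≤ (N : ℝ) ^ (1 - δ) := by
  set D := (GenContFract.of α).dens with hD
  obtain ⟨n₀, hn₀⟩ := eventually_atTop.1 (h δ hδ)
  have hmono : Monotone D := monotone_nat_of_le_succ fun n => GenContFract.of_den_mono
  have hN : Tendsto (fun N : ℕ => (N : ℝ) ^ (1 - δ)) atTop atTop :=
    (tendsto_rpow_atTop (by linarith)).comp tendsto_natCast_atTop_atTop
  filter_upwards [hN.eventually_ge_atTop (D n₀), eventually_ge_atTop 1] with N hN₀ hN1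
  have hex : ∃ m, (N : ℝ) ^ (1 - δ) < D m :=
    ((tendsto_dens hα).eventually_gt_atTop _).exists
  classical
  -- `m` is the first index with denominator above `N ^ (1 - δ)`. The denominator just before it is
  -- the one sought: the Roth condition forbids it from being much smaller.
  set m := Nat.find hex with hm
  have hm1 : (N : ℝ) ^ (1 - δ) < D m := Nat.find_spec hex
  have hmn : n₀ < m := by
    by_contra hc
    exact absurd (hmono (not_lt.1 hc)) (not_le.2 (hN₀.trans_lt hm1))
  obtain ⟨k, hk⟩ := Nat.exists_eq_add_of_le' (Nat.zero_lt_of_lt hmn)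
  have hk1 : D k ≤ (N : ℝ) ^ (1 - δ) := not_lt.1 (Nat.find_min hex (by omega))
  obtain ⟨p, q, hq, hpq, hqD, happ⟩ := exists_convergent hα k
  have hq' : (0 : ℝ) < q := by exact_mod_cast hq
  rw [← hD] at hqD happ
  refine ⟨p, q, hq, hpq, happ.trans ?_, ?_, hqD ▸ hk1⟩
  · rw [hqD] at hq' ⊢
    exact one_div_le_one_div_of_le hq' (hmono k.le_succ)
  · have h1 : (N : ℝ) ^ (1 - δ) < (q : ℝ) ^ (1 + δ) := by
      rw [hk] at hm1
      rw [hqD]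
      exact hm1.trans (hn₀ k (by omega))
    by_contra hc
    have hN' : (1 : ℝ) ≤ N := by exact_mod_cast hN1
    have h2 : (q : ℝ) ^ (1 + δ) ≤ ((N : ℝ) ^ (1 - 2 * δ)) ^ (1 + δ) :=
      Real.rpow_le_rpow hq'.le (not_le.1 hc).le (by linarith)
    rw [← Real.rpow_mul (by positivity)] at h2
    -- `(1 - 2δ)(1 + δ) = 1 - δ - 2δ²`.
    have h3 : (N : ℝ) ^ ((1 - 2 * δ) * (1 + δ)) ≤ (N : ℝ) ^ (1 - δ) :=
      Real.rpow_le_rpow_of_exponent_le hN' (by nlinarith)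
    linarith

/-- If `α` is not of Roth type, it has arbitrarily long very good approximations. -/
theorem exists_good_approx_of_not_isRothType {α : ℝ} (hα : Irrational α) (h : ¬ IsRothType α) :
    ∃ ε : ℝ, 0 < ε ∧ ∀ Q : ℝ, ∃ (p : ℤ) (q : ℕ), Q ≤ q ∧ 0 < q ∧ IsCoprime p (q : ℤ) ∧
      0 < |q * α - p| ∧ |q * α - p| ≤ 1 / (q : ℝ) ^ (1 + ε) := by
  unfold IsRothType at h
  push Not at h
  obtain ⟨ε, hε, hf⟩ := h
  refine ⟨ε, hε, fun Q => ?_⟩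
  obtain ⟨n, hn, hQ⟩ := (hf.and_eventually ((tendsto_dens hα).eventually_ge_atTop Q)).exists
  obtain ⟨p, q, hq, hpq, hqD, happ⟩ := exists_convergent hα n
  have hq' : (0 : ℝ) < q := by exact_mod_cast hq
  refine ⟨p, q, hqD ▸ hQ, hq, hpq, ?_, happ.trans ?_⟩
  · rw [abs_pos, sub_ne_zero]
    exact (hα.natCast_mul hq.ne').ne_int p
  · rw [← hqD] at hn
    exact one_div_le_one_div_of_le (by positivity) hn

/-! ### Invariance of Lebesgue measure and first moments -/

/-- Up to a translation, the preimage of `s` is the 1-periodic extension of `s` cut by a shifted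
unit interval, and a periodic set has the same measure in every fundamental domain. -/
theorem measurePreserving_fract_add (a : ℝ) :
    MeasurePreserving (fun x : ℝ => Int.fract (x + a)) (volume.restrict (Set.Ico 0 1))
      (volume.restrict (Set.Ico 0 1)) := by
  have hmeas : Measurable fun x : ℝ => Int.fract (x + a) := (measurable_id.add_const a).fract
  refine ⟨hmeas, Measure.ext fun s hs => ?_⟩
  rw [Measure.map_apply hmeas hs]
  have hA : MeasurableSet {z : ℝ | Int.fract z ∈ s} := measurable_fract hs
  have hI : (volume.restrict (Set.Ico 0 1) : Measure ℝ) = volume.restrict (Set.Ioc 0 1) :=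
    Measure.restrict_congr_set Ico_ae_eq_Ioc
  have hfund : volume ({z : ℝ | Int.fract z ∈ s} ∩ Set.Ioc a (a + 1)) =
      volume ({z : ℝ | Int.fract z ∈ s} ∩ Set.Ioc 0 (0 + 1)) := by
    refine (isAddFundamentalDomain_Ioc one_pos a).measure_set_eq
      (isAddFundamentalDomain_Ioc one_pos 0) hA ?_
    rintro ⟨g, k, rfl⟩
    ext z
    simp [AddSubgroup.vadd_def]
  calc (volume.restrict (Set.Ico 0 1)) ((fun x : ℝ => Int.fract (x + a)) ⁻¹' s)
      = volume ((fun x : ℝ => Int.fract (x + a)) ⁻¹' s ∩ Set.Ioc 0 1) := by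
        rw [hI, Measure.restrict_apply (hmeas hs)]
    _ = volume ((fun x : ℝ => x + a) ⁻¹' ({z : ℝ | Int.fract z ∈ s} ∩ Set.Ioc a (a + 1))) := by
        congr 1
        ext z
        simp [add_comm a 1]
    _ = volume ({z : ℝ | Int.fract z ∈ s} ∩ Set.Ioc 0 1) := by
        rw [measure_preimage_add_right, hfund, zero_add]
    _ = (volume.restrict (Set.Ico 0 1)) {z : ℝ | Int.fract z ∈ s} := by
        rw [hI, Measure.restrict_apply hA]
    _ = (volume.restrict (Set.Ico 0 1)) s := by
        rw [Measure.restrict_apply hA, Measure.restrict_apply hs]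
        congr 1
        ext z
        simp only [Set.mem_inter_iff, Set.mem_ofPred_eq, and_congr_left_iff]
        intro hz
        rw [Int.fract_eq_self.2 hz]

theorem measure_fract_add_lt (a : ℝ) {s : ℝ} (hs : s ≤ 1) :
    (volume.restrict (Set.Ico 0 1)) {x : ℝ | Int.fract (x + a) < s} = ENNReal.ofReal s := by
  have h := (measurePreserving_fract_add a).measure_preimage
    (measurableSet_Iio (a := s)).nullMeasurableSet
  change (volume.restrict (Set.Ico 0 1)) {x : ℝ | Int.fract (x + a) < s} = _ at h
  rw [h, Measure.restrict_apply measurableSet_Iio]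
  have : Set.Iio s ∩ Set.Ico 0 1 = Set.Ico 0 s := by
    ext z
    simp only [Set.mem_inter_iff, Set.mem_Iio, Set.mem_Ico]
    constructor
    · exact fun h => ⟨h.2.1, h.1⟩
    · exact fun h => ⟨h.2, h.1, h.2.trans_le hs⟩
  rw [this, Real.volume_Ico, sub_zero]

/-- The observable `1 / x` restricted to `[a, b)`. -/
noncomputable def windowObservable (a b : ℝ) : ℝ → ℝ :=
  (Set.Ico a b).indicator fun y => 1 / y

theorem windowObservable_nonneg {a : ℝ} (ha : 0 < a) (b y : ℝ) : 0 ≤ windowObservable a b y :=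
  Set.indicator_nonneg (fun z hz => by have := ha.trans_le hz.1; positivity) y

theorem measurable_windowObservable (a b : ℝ) : Measurable (windowObservable a b) :=
  (measurable_const.div measurable_id).indicator measurableSet_Ico

theorem lintegral_windowObservable {a b : ℝ} (ha : 0 < a) (hab : a ≤ b) (hb : b ≤ 1) :
    ∫⁻ y, ENNReal.ofReal (windowObservable a b y) ∂(volume.restrict (Set.Ico 0 1)) =
      ENNReal.ofReal (Real.log (b / a)) := by
  have h0 : (0 : ℝ) ∉ Set.uIcc a b := by
    rw [Set.uIcc_of_le hab]
    exact fun h => absurd h.1 (not_le.2 ha)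
  have hint : IntegrableOn (fun y : ℝ => 1 / y) (Set.Ico a b) :=
    (integrableOn_Icc_iff_integrableOn_Ico).1
      ((ContinuousOn.div continuousOn_const continuousOn_id fun y hy => by
        exact (ha.trans_le hy.1).ne').integrableOn_Icc)
  have hg : Integrable (windowObservable a b) (volume.restrict (Set.Ico 0 1)) :=
    ((integrable_indicator_iff measurableSet_Ico).2 hint).restrict
  rw [← ofReal_integral_eq_lintegral_ofReal hg
    (Eventually.of_forall fun y => windowObservable_nonneg ha b y)]
  congr 1
  unfold windowObservable
  rw [setIntegral_indicator measurableSet_Ico]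
  have : Set.Ico (0 : ℝ) 1 ∩ Set.Ico a b = Set.Ico a b :=
    Set.inter_eq_right.2 (Set.Ico_subset_Ico ha.le hb)
  rw [this, integral_Ico_eq_integral_Ioc, ← intervalIntegral.integral_of_le hab, integral_one_div h0]

/-- Markov's inequality for ergodic sums of the truncated observable. -/
theorem measure_sum_windowObservable_gt_le {a b M : ℝ} (ha : 0 < a) (hab : a ≤ b) (hb : b ≤ 1)
    (hM : 0 < M) (c : ℕ → ℝ) (N : ℕ) :
    (volume.restrict (Set.Ico 0 1))
        {x : ℝ | M < ∑ n ∈ Finset.range N, windowObservable a b (Int.fract (x + c n))} ≤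
      ENNReal.ofReal (N * Real.log (b / a) / M) := by
  have hmeas : ∀ n, Measurable fun x : ℝ =>
      ENNReal.ofReal (windowObservable a b (Int.fract (x + c n))) := fun n =>
    ((measurable_windowObservable a b).comp (measurable_id.add_const (c n)).fract).ennreal_ofReal
  calc _ ≤ (volume.restrict (Set.Ico 0 1)) {x : ℝ | ENNReal.ofReal M ≤
        ∑ n ∈ Finset.range N, ENNReal.ofReal (windowObservable a b (Int.fract (x + c n)))} := by
        refine measure_mono fun x hx => ?_
        rw [Set.mem_ofPred_eq] at hx ⊢
        rw [← ENNReal.ofReal_sum_of_nonneg fun n _ => windowObservable_nonneg ha b _]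
        exact ENNReal.ofReal_le_ofReal hx.le
    _ ≤ (∫⁻ x, ∑ n ∈ Finset.range N, ENNReal.ofReal (windowObservable a b (Int.fract (x + c n)))
          ∂(volume.restrict (Set.Ico 0 1))) / ENNReal.ofReal M :=
        meas_ge_le_lintegral_div (Finset.measurable_sum _ fun n _ => hmeas n).aemeasurable
          (by simpa using hM) ENNReal.ofReal_ne_top
    _ = (∑ n ∈ Finset.range N, ENNReal.ofReal (Real.log (b / a))) / ENNReal.ofReal M := by
        rw [lintegral_finsetSum _ fun n _ => hmeas n]
        congr 1
        refine Finset.sum_congr rfl fun n _ => ?_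
        rw [← lintegral_windowObservable ha hab hb]
        exact (measurePreserving_fract_add (c n)).lintegral_comp
          (measurable_windowObservable a b).ennreal_ofReal
    _ = ENNReal.ofReal (N * Real.log (b / a) / M) := by
        rw [Finset.sum_const, Finset.card_range, nsmul_eq_mul, ENNReal.ofReal_div_of_pos hM,
          ENNReal.ofReal_mul (Nat.cast_nonneg N), ENNReal.ofReal_natCast]

/-! ### Denjoy–Koksma estimates along orbit segments -/

theorem rotation_iterate (α x : ℝ) (n : ℕ) (hx : x ∈ Set.Ico (0 : ℝ) 1) :
    (rotation α)^[n] x = Int.fract (x + n * α) := by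
  induction n with
  | zero => simpa using (Int.fract_eq_self.2 hx).symm
  | succ n ih =>
    rw [Function.iterate_succ_apply', ih, rotation, Int.fract_eq_fract]
    exact ⟨-⌊x + n * α⌋, by rw [Int.fract]; push_cast; ring⟩

theorem ergodicSum_eq {α x : ℝ} (hx : x ∈ Set.Ico (0 : ℝ) 1) (N : ℕ) :
    ergodicSum α N x = ∑ n ∈ Finset.range N, 1 / Int.fract (x + n * α) := by
  unfold ergodicSum birkhoffSum observable
  exact Finset.sum_congr rfl fun n _ => by rw [rotation_iterate α x n hx]

/-- Since `p` is invertible modulo `q`, `n ↦ n p + a` permutes the residues. -/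
theorem sum_range_emod_eq {q : ℕ} (hq : 0 < q) {p : ℤ} (hpq : IsCoprime p (q : ℤ)) (a : ℤ)
    (F : ℕ → ℝ) :
    ∑ n ∈ Finset.range q, F (((n * p + a) % q).toNat) = ∑ c ∈ Finset.range q, F c := by
  have hq' : (0 : ℤ) < q := by exact_mod_cast hq
  have hmap : ∀ n ∈ Finset.range q, (((n : ℤ) * p + a) % q).toNat ∈ Finset.range q := by
    intro n _
    have h1 := Int.emod_nonneg ((n : ℤ) * p + a) hq'.ne'
    have h2 := Int.emod_lt_of_pos ((n : ℤ) * p + a) hq'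
    rw [Finset.mem_range]
    omega
  have hinj : Set.InjOn (fun n : ℕ => (((n : ℤ) * p + a) % q).toNat) (Finset.range q) := by
    intro n hn m hm hnm
    have h1 := Int.emod_nonneg ((n : ℤ) * p + a) hq'.ne'
    have h2 := Int.emod_nonneg ((m : ℤ) * p + a) hq'.ne'
    have h3 : ((n : ℤ) * p + a) % q = ((m : ℤ) * p + a) % q := by
      simp only at hnm
      omega
    have h4 : (q : ℤ) ∣ ((n : ℤ) - m) * p := by
      have := Int.ModEq.dvd (Int.ModEq.symm (show ((n : ℤ) * p + a) ≡ (m * p + a) [ZMOD q] from h3))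
      convert this using 1
      ring
    have h5 : (q : ℤ) ∣ (n : ℤ) - m := hpq.symm.dvd_of_dvd_mul_right h4
    have h6 : (n : ℤ) - m = 0 := by
      refine Int.eq_zero_of_abs_lt_dvd h5 ?_
      simp only [Finset.coe_range, Set.mem_Iio] at hn hm
      rw [abs_lt]
      omega
    omega
  refine Finset.sum_nbij _ hmap hinj ?_ fun _ _ => rfl
  exact Finset.surjOn_of_injOn_of_card_le _ hmap hinj le_rfl

theorem sum_antitone_le_integral {h : ℝ → ℝ} (hanti : Antitone h) {q : ℕ} (hq : 0 < q) :
    ∑ i ∈ Finset.range q, h (((i + 1 : ℕ) : ℝ) / q) ≤ q * ∫ x in (0 : ℝ)..1, h x := by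
  have hq' : (0 : ℝ) < q := by exact_mod_cast hq
  have hmono : Antitone fun t : ℝ => h (t / q) := fun s t hst => hanti (by gcongr)
  have := (hmono.antitoneOn (Set.Icc 0 (0 + (q : ℝ)))).sum_le_integral
  rw [intervalIntegral.integral_comp_div h hq'.ne'] at this
  simpa [hq'.ne'] using this

theorem integral_le_sum_antitone {h : ℝ → ℝ} (hanti : Antitone h) {q : ℕ} (hq : 0 < q) :
    q * ∫ x in (0 : ℝ)..1, h x ≤ ∑ i ∈ Finset.range q, h ((i : ℝ) / q) := by
  have hq' : (0 : ℝ) < q := by exact_mod_cast hq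
  have hmono : Antitone fun t : ℝ => h (t / q) := fun s t hst => hanti (by gcongr)
  have := (hmono.antitoneOn (Set.Icc 0 (0 + (q : ℝ)))).integral_le_sum
  rw [intervalIntegral.integral_comp_div h hq'.ne'] at this
  simpa [hq'.ne'] using this

/-- The points of an orbit segment of length `q` fall into the cells `[c / q, (c + 1) / q)`, one
for each `c`, up to moving by at most one cell. -/
theorem fract_orbit_mem {α : ℝ} {p : ℤ} {q : ℕ} (hq : 0 < q) (happ : |q * α - p| ≤ 1 / q)
    (x : ℝ) {n c : ℕ} (hn : n < q) (hc : c = ((n * p + ⌊x * q⌋) % q).toNat) (hc0 : c ≠ 0)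
    (hc1 : c + 1 ≠ q) :
    ((c : ℝ) - 1) / q ≤ Int.fract (x + n * α) ∧ Int.fract (x + n * α) ≤ ((c : ℝ) + 2) / q := by
  have hq' : (0 : ℝ) < q := by exact_mod_cast hq
  have hqz : (0 : ℤ) < q := by exact_mod_cast hq
  set m : ℤ := n * p + ⌊x * q⌋ with hm
  have h1 := Int.emod_nonneg m hqz.ne'
  have h2 := Int.emod_lt_of_pos m hqz
  have hcz : (c : ℤ) = m % q := by omega
  have hc2 : c + 2 ≤ q := by omega
  have hc1' : 1 ≤ c := by omega
  have hc2' : (c : ℝ) + 2 ≤ q := by exact_mod_cast hc2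
  have hc1'' : (1 : ℝ) ≤ c := by exact_mod_cast hc1'
  have hmd : (m : ℝ) = q * (m / q : ℤ) + c := by
    have := (Int.mul_ediv_add_emod m q).symm
    rw [← hcz] at this
    exact_mod_cast this
  have hm' : (m : ℝ) = n * p + ⌊x * q⌋ := by rw [hm]; push_cast; ring
  -- In units of `1 / q` the orbit point is `c + e` modulo `q`. The drift `n (q α - p)` is less than
  -- 1 in modulus, so `-1 < e < 2`; excluding the two end cells prevents wrapping around.
  set e : ℝ := Int.fract (x * q) + n * (q * α - p) with he
  have hnβ : |(n : ℝ) * (q * α - p)| < 1 := by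
    rw [abs_mul, Nat.abs_cast]
    have hn' : (n : ℝ) < q := by exact_mod_cast hn
    calc (n : ℝ) * |q * α - p| ≤ n * (1 / q) := by gcongr
      _ < q * (1 / q) := by gcongr
      _ = 1 := by field_simp
  have he1 : -1 < e := by
    have := Int.fract_nonneg (x * q)
    have := (abs_lt.1 hnβ).1
    linarith
  have he2 : e < 2 := by
    have := Int.fract_lt_one (x * q)
    have := (abs_lt.1 hnβ).2
    linarith
  have hx : x + n * α = (m / q : ℤ) + (c + e) / q := by
    have hfl := Int.floor_add_fract (x * q)
    field_simp
    rw [he]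
    linear_combination hmd - hm' - hfl
  have hfr : Int.fract (x + n * α) = (c + e) / q := by
    rw [hx, Int.fract_intCast_add]
    refine Int.fract_eq_self.2 ⟨div_nonneg (by linarith) hq'.le, ?_⟩
    rw [div_lt_one hq']
    linarith
  rw [hfr]
  constructor <;> exact div_le_div_of_nonneg_right (by linarith) hq'.le

/-- A Denjoy–Koksma type inequality for monotone observables. -/
theorem abs_sum_orbit_sub_le {α : ℝ} {p : ℤ} {q : ℕ} (hq : 0 < q) (hpq : IsCoprime p (q : ℤ))
    (happ : |q * α - p| ≤ 1 / q) {h : ℝ → ℝ} (hanti : Antitone h) {H : ℝ} (h0 : ∀ x, 0 ≤ h x)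
    (hH : ∀ x, h x ≤ H) (x : ℝ) :
    |∑ n ∈ Finset.range q, h (Int.fract (x + n * α)) - q * ∫ x in (0 : ℝ)..1, h x| ≤ 5 * H := by
  have hq' : (0 : ℝ) < q := by exact_mod_cast hq
  have hqz : (0 : ℤ) < q := by exact_mod_cast hq
  have hH0 : 0 ≤ H := (h0 0).trans (hH 0)
  -- A point assigned to an end cell may wrap around, so the trivial error `H` is charged there. The
  -- two terms are added because the end cells coincide when `q = 1`.
  set E : ℕ → ℝ := fun c => (if c = 0 then H else 0) + (if c = q - 1 then H else 0) with hE
  have hE0 : ∀ c, 0 ≤ E c := fun c => by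
    simp only [hE]
    split_ifs <;> linarith
  have hE1 : ∀ c, c = 0 ∨ c + 1 = q → H ≤ E c := fun c hc => by
    simp only [hE]
    rcases hc with hc | hc
    · rw [if_pos hc]; split_ifs <;> linarith
    · rw [if_pos (show c = q - 1 by omega)]; split_ifs <;> linarith
  have hEsum : ∑ c ∈ Finset.range q, E c ≤ 2 * H := by
    simp only [hE]
    rw [Finset.sum_add_distrib, Finset.sum_ite_eq', Finset.sum_ite_eq']
    split_ifs <;> linarith
  have hpt : ∀ n ∈ Finset.range q, ∀ c, c = ((n * p + ⌊x * q⌋) % q).toNat →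
      h (((c : ℝ) + 2) / q) - E c ≤ h (Int.fract (x + n * α)) ∧
      h (Int.fract (x + n * α)) ≤ h (((c : ℝ) - 1) / q) + E c := by
    intro n hn c hc
    by_cases hcc : c = 0 ∨ c + 1 = q
    · have := hE1 c hcc
      exact ⟨by linarith [hH (((c : ℝ) + 2) / q), h0 (Int.fract (x + n * α))],
        by linarith [h0 (((c : ℝ) - 1) / q), hH (Int.fract (x + n * α))]⟩
    · push Not at hcc
      obtain ⟨h1, h2⟩ := fract_orbit_mem hq happ x (Finset.mem_range.1 hn) hc hcc.1 hcc.2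
      exact ⟨by linarith [hanti h2, hE0 c], by linarith [hanti h1, hE0 c]⟩
  have hup : ∑ n ∈ Finset.range q, h (Int.fract (x + n * α)) ≤
      ∑ c ∈ Finset.range q, (h (((c : ℝ) - 1) / q) + E c) := by
    rw [← sum_range_emod_eq hq hpq ⌊x * q⌋ fun c => h (((c : ℝ) - 1) / q) + E c]
    exact Finset.sum_le_sum fun n hn => (hpt n hn _ rfl).2
  have hlo : ∑ c ∈ Finset.range q, (h (((c : ℝ) + 2) / q) - E c) ≤
      ∑ n ∈ Finset.range q, h (Int.fract (x + n * α)) := by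
    rw [← sum_range_emod_eq hq hpq ⌊x * q⌋ fun c => h (((c : ℝ) + 2) / q) - E c]
    exact Finset.sum_le_sum fun n hn => (hpt n hn _ rfl).1
  rw [Finset.sum_add_distrib] at hup
  rw [Finset.sum_sub_distrib] at hlo
  -- Moving every sample by one cell telescopes to two boundary values. Two such moves and the end
  -- cells cost `4 H` in each direction, within the stated `5 H`.
  have shift : ∀ s : ℝ, |∑ c ∈ Finset.range q, h (((c : ℝ) + (s + 1)) / q) -
      ∑ c ∈ Finset.range q, h (((c : ℝ) + s) / q)| ≤ H := by
    intro s
    rw [← Finset.sum_sub_distrib]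
    have : ∀ c ∈ Finset.range q, h (((c : ℝ) + (s + 1)) / q) - h (((c : ℝ) + s) / q) =
        (fun c : ℕ => h (((c : ℝ) + s) / q)) (c + 1) - (fun c : ℕ => h (((c : ℝ) + s) / q)) c := by
      intro c _
      simp only
      push_cast
      congr 3
      ring
    rw [Finset.sum_congr rfl this, Finset.sum_range_sub (fun c : ℕ => h (((c : ℝ) + s) / q)), abs_le]
    constructor
    · linarith [h0 (((q : ℕ) + s) / q), hH (((0 : ℕ) + s) / q)]
    · linarith [hH (((q : ℕ) + s) / q), h0 (((0 : ℕ) + s) / q)]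
  have s1 := abs_le.1 (shift (-1))
  have s2 := abs_le.1 (shift 0)
  have s3 := abs_le.1 (shift 1)
  norm_num [← sub_eq_add_neg] at s1 s2 s3
  have i1 := sum_antitone_le_integral hanti hq
  have i2 := integral_le_sum_antitone hanti hq
  push_cast at i1
  rw [abs_le]
  constructor
  · linarith [s2.1, s3.1]
  · linarith [s1.1, s2.1]

theorem abs_sum_orbit_mul_sub_le {α : ℝ} {p : ℤ} {q : ℕ} (hq : 0 < q) (hpq : IsCoprime p (q : ℤ))
    (happ : |q * α - p| ≤ 1 / q) {h : ℝ → ℝ} (hanti : Antitone h) {H : ℝ} (h0 : ∀ x, 0 ≤ h x)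
    (hH : ∀ x, h x ≤ H) (x : ℝ) (b : ℕ) :
    |∑ n ∈ Finset.range (b * q), h (Int.fract (x + n * α)) - b * q * ∫ x in (0 : ℝ)..1, h x| ≤
      b * (5 * H) := by
  induction b with
  | zero => simp
  | succ b ih =>
    have h1 := abs_sum_orbit_sub_le hq hpq happ hanti h0 hH (x + (b * q : ℕ) * α)
    rw [add_mul, one_mul, Finset.sum_range_add]
    have h2 : ∑ n ∈ Finset.range q, h (Int.fract (x + (b * q + n : ℕ) * α)) =
        ∑ n ∈ Finset.range q, h (Int.fract (x + (b * q : ℕ) * α + n * α)) := by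
      refine Finset.sum_congr rfl fun n _ => ?_
      push_cast
      congr 2
      ring
    rw [h2]
    push_cast at h1 ⊢
    rw [abs_le] at *
    constructor <;> linarith

/-- Ergodic sums of a monotone observable along an orbit segment of arbitrary length `N`, estimated
through a single convergent denominator `q`. -/
theorem abs_sum_orbit_sub_le_of_length {α : ℝ} {p : ℤ} {q : ℕ} (hq : 0 < q)
    (hpq : IsCoprime p (q : ℤ)) (happ : |q * α - p| ≤ 1 / q) {h : ℝ → ℝ} (hanti : Antitone h)
    {H : ℝ} (h0 : ∀ x, 0 ≤ h x) (hH : ∀ x, h x ≤ H) (x : ℝ) (N : ℕ) :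
    |∑ n ∈ Finset.range N, h (Int.fract (x + n * α)) - N * ∫ x in (0 : ℝ)..1, h x| ≤
      q * (∫ x in (0 : ℝ)..1, h x) + (N / q + 1) * (5 * H) := by
  have hq' : (0 : ℝ) < q := by exact_mod_cast hq
  have hH0 : 0 ≤ H := (h0 0).trans (hH 0)
  set I := ∫ x in (0 : ℝ)..1, h x with hI
  have hI0 : 0 ≤ I := intervalIntegral.integral_nonneg zero_le_one fun x _ => h0 x
  have hNb : N / q * q ≤ N := Nat.div_mul_le_self N q
  have hNb' : N ≤ (N / q + 1) * q := by
    have := Nat.div_add_mod N q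
    have := Nat.mod_lt N hq
    nlinarith
  -- As `h` is nonnegative, the sum lies between those over `⌊N / q⌋` and `⌊N / q⌋ + 1` full blocks.
  have hlo : ∑ n ∈ Finset.range (N / q * q), h (Int.fract (x + n * α)) ≤
      ∑ n ∈ Finset.range N, h (Int.fract (x + n * α)) :=
    Finset.sum_le_sum_of_subset_of_nonneg (Finset.range_mono hNb) fun n _ _ => h0 _
  have hup : ∑ n ∈ Finset.range N, h (Int.fract (x + n * α)) ≤
      ∑ n ∈ Finset.range ((N / q + 1) * q), h (Int.fract (x + n * α)) :=
    Finset.sum_le_sum_of_subset_of_nonneg (Finset.range_mono hNb') fun n _ _ => h0 _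
  have b1 := abs_le.1 (abs_sum_orbit_mul_sub_le hq hpq happ hanti h0 hH x (N / q))
  have b2 := abs_le.1 (abs_sum_orbit_mul_sub_le hq hpq happ hanti h0 hH x (N / q + 1))
  rw [← hI] at b1 b2
  have hbd : ((N / q : ℕ) : ℝ) ≤ N / q := Nat.cast_div_le
  have c1 : ((N / q : ℕ) : ℝ) * q ≤ N := by exact_mod_cast hNb
  have c2 : (N : ℝ) ≤ ((N / q : ℕ) + 1) * q := by exact_mod_cast hNb'
  have d1 : ((N / q : ℕ) : ℝ) * (5 * H) ≤ N / q * (5 * H) := by gcongr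
  have d2 : ((N / q : ℕ) : ℝ) * q * I ≤ N * I := by gcongr
  have d3 : (N : ℝ) * I ≤ ((N / q : ℕ) + 1) * q * I := by gcongr
  push_cast at b2
  rw [abs_le]
  constructor <;> nlinarith [b1.1, b2.2]

/-! ### The weak law for Roth type -/

/-- The observable `1 / x` capped at height `1 / θ`. -/
noncomputable def cappedObservable (θ x : ℝ) : ℝ := 1 / max x θ

theorem antitone_cappedObservable {θ : ℝ} (hθ : 0 < θ) : Antitone (cappedObservable θ) :=
  fun _ _ hxy => one_div_le_one_div_of_le (lt_max_of_lt_right hθ) (max_le_max_right θ hxy)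

theorem cappedObservable_nonneg {θ : ℝ} (hθ : 0 < θ) (x : ℝ) : 0 ≤ cappedObservable θ x :=
  (one_div_pos.2 (lt_max_of_lt_right hθ)).le

theorem cappedObservable_le {θ : ℝ} (hθ : 0 < θ) (x : ℝ) : cappedObservable θ x ≤ 1 / θ :=
  one_div_le_one_div_of_le hθ (le_max_right x θ)

theorem integral_cappedObservable {θ : ℝ} (hθ : 0 < θ) (hθ1 : θ ≤ 1) :
    ∫ x in (0 : ℝ)..1, cappedObservable θ x = 1 - Real.log θ := by
  have hi : ∀ a b : ℝ, IntervalIntegrable (cappedObservable θ) volume a b := fun a b =>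
    (antitone_cappedObservable hθ).intervalIntegrable
  rw [← intervalIntegral.integral_add_adjacent_intervals (hi 0 θ) (hi θ 1)]
  have h1 : ∫ x in (0 : ℝ)..θ, cappedObservable θ x = ∫ _ in (0 : ℝ)..θ, 1 / θ := by
    refine intervalIntegral.integral_congr fun x hx => ?_
    rw [Set.uIcc_of_le hθ.le] at hx
    simp only [cappedObservable, max_eq_right hx.2]
  have h2 : ∫ x in θ..1, cappedObservable θ x = ∫ x in θ..1, 1 / x := by
    refine intervalIntegral.integral_congr fun x hx => ?_
    rw [Set.uIcc_of_le hθ1] at hx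
    simp only [cappedObservable, max_eq_left hx.1]
  have h0 : (0 : ℝ) ∉ Set.uIcc θ 1 := by
    rw [Set.uIcc_of_le hθ1]
    exact fun h => absurd h.1 (not_le.2 hθ)
  rw [h1, h2, integral_one_div h0, intervalIntegral.integral_const, smul_eq_mul, sub_zero,
    mul_one_div_cancel hθ.ne', one_div, Real.log_inv]
  ring

theorem tendsto_zero_of_eventually_le_ofReal {f : ℕ → ENNReal}
    (h : ∀ ρ : ℝ, 0 < ρ → ∀ᶠ N in atTop, f N ≤ ENNReal.ofReal ρ) : Tendsto f atTop (𝓝 0) := by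
  rw [ENNReal.tendsto_nhds_zero]
  intro e he
  obtain ⟨r, hr0, hre⟩ := ENNReal.lt_iff_exists_nnreal_btwn.1 he
  filter_upwards [h r (by exact_mod_cast hr0)] with N hN
  exact hN.trans (by rw [ENNReal.ofReal_coe_nnreal]; exact hre.le)

theorem IsRothType.abs_sum_cappedObservable_sub_le {α : ℝ} (hα : Irrational α) (h : IsRothType α)
    {δ : ℝ} (hδ : 0 < δ) (hδ1 : δ ≤ 1 / 8) :
    ∀ᶠ N : ℕ in atTop, ∀ x : ℝ,
      |∑ n ∈ Finset.range N, cappedObservable ((N : ℝ) ^ (3 * δ - 1)) (Int.fract (x + n * α)) -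
        N * Real.log N| ≤ 4 * δ * (N * Real.log N) := by
  have hlog : Tendsto (fun N : ℕ => Real.log N) atTop atTop :=
    Real.tendsto_log_atTop.comp tendsto_natCast_atTop_atTop
  have hpow : Tendsto (fun N : ℕ => (N : ℝ) ^ δ) atTop atTop :=
    (tendsto_rpow_atTop hδ).comp tendsto_natCast_atTop_atTop
  -- The integral of the capped function is `1 + (1 - 3δ) log N`. The bound `log N ≥ 1 / δ` absorbs
  -- the `1`; the other two absorb the Denjoy–Koksma error `N ^ (1 - δ) (11 + log N)` into `δ N log
  -- N`. Together with the `3δ` this makes `4δ`.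
  filter_upwards [h.exists_convergent_mem hα hδ (by linarith), eventually_ge_atTop 1,
    hlog.eventually_ge_atTop 11, hlog.eventually_ge_atTop (1 / δ),
    hpow.eventually_ge_atTop (2 / δ)] with N ⟨p, q, hq, hpq, happ, hq1, hq2⟩ hN hL hL' hP x
  have hN1 : (1 : ℝ) ≤ N := by exact_mod_cast hN
  have hN0 : (0 : ℝ) < N := by linarith
  have hq0 : (0 : ℝ) < q := by exact_mod_cast hq
  set θ : ℝ := (N : ℝ) ^ (3 * δ - 1) with hθ
  have hθ0 : 0 < θ := by positivity
  have hθ1 : θ ≤ 1 := Real.rpow_le_one_of_one_le_of_nonpos hN1 (by linarith)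
  have key := abs_sum_orbit_sub_le_of_length hq hpq happ (antitone_cappedObservable hθ0)
    (cappedObservable_nonneg hθ0) (cappedObservable_le hθ0) x N
  rw [integral_cappedObservable hθ0 hθ1] at key
  have hlogθ : Real.log θ = (3 * δ - 1) * Real.log N := Real.log_rpow hN0 _
  set L := Real.log N with hLdef
  set P := (N : ℝ) ^ (1 - δ) with hPdef
  have hP0 : 0 < P := by positivity
  have hNP : (N : ℝ) = P * (N : ℝ) ^ δ := by
    rw [hPdef, ← Real.rpow_add hN0]
    simp
  have e1 : q * (1 - Real.log θ) ≤ P * (1 + L) := by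
    have : 1 - Real.log θ ≤ 1 + L := by
      rw [hlogθ]
      nlinarith
    have h0 : (0 : ℝ) ≤ 1 + L := by linarith
    calc q * (1 - Real.log θ) ≤ q * (1 + L) := by gcongr
      _ ≤ P * (1 + L) := by gcongr
  have e2 : (N / q + 1) * (5 * (1 / θ)) ≤ 10 * P := by
    have h1 : (N : ℝ) / q ≤ (N : ℝ) ^ (2 * δ) := by
      rw [div_le_iff₀ hq0]
      calc (N : ℝ) = (N : ℝ) ^ (2 * δ) * (N : ℝ) ^ (1 - 2 * δ) := by
            rw [← Real.rpow_add hN0]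
            simp
        _ ≤ _ := by gcongr
    have h2 : (1 : ℝ) ≤ (N : ℝ) ^ (2 * δ) := Real.one_le_rpow hN1 (by linarith)
    have h3 : P = (N : ℝ) ^ (2 * δ) * (1 / θ) := by
      rw [hθ, one_div, ← Real.rpow_neg hN0.le, ← Real.rpow_add hN0, hPdef]
      congr 1
      ring
    rw [h3]
    have h4 : 0 < 1 / θ := by positivity
    nlinarith
  have e3 : P * (11 + L) ≤ δ * (N * L) := by
    rw [div_le_iff₀ hδ] at hP
    rw [hNP]
    have : 11 + L ≤ (N : ℝ) ^ δ * δ * L := by nlinarith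
    calc P * (11 + L) ≤ P * ((N : ℝ) ^ δ * δ * L) := by gcongr
      _ = _ := by ring
  have e4 : (N : ℝ) ≤ δ * (N * L) := by
    rw [div_le_iff₀ hδ] at hL'
    nlinarith
  have k := abs_le.1 key
  rw [hlogθ] at k e1
  have hNL : 0 ≤ δ * (N * L) := by positivity
  rw [abs_le]
  constructor
  · linarith [k.1]
  · linarith [k.2]

theorem cappedObservable_le_one_div {θ y : ℝ} (hy : 0 < y) : cappedObservable θ y ≤ 1 / y :=
  one_div_le_one_div_of_le hy (le_max_left y θ)

theorem one_div_le_cappedObservable_add {a θ y : ℝ} (ha : 0 < a) (hθ : 0 < θ) (hy : a ≤ y) :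
    1 / y ≤ cappedObservable θ y + windowObservable a θ y := by
  rcases le_or_gt θ y with h | h
  · rw [cappedObservable, max_eq_left h]
    exact le_add_of_nonneg_right (windowObservable_nonneg ha θ y)
  · rw [windowObservable, Set.indicator_of_mem (Set.mem_Ico.2 ⟨hy, h⟩)]
    exact le_add_of_nonneg_left (cappedObservable_nonneg hθ y)

theorem IsRothType.weakLaw {α : ℝ} (hα : Irrational α) (h : IsRothType α) :
    WeakLaw α fun N : ℕ => (N : ℝ) * Real.log (N : ℝ) := by
  intro κ hκ
  refine tendsto_zero_of_eventually_le_ofReal fun ρ hρ => ?_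
  -- `κ / 8` keeps the capped error below half of the tolerance; `ρ κ / 16` makes the Markov bound
  -- at level `κ / 2 * (N log N)` at most `ρ / 2`.
  set δ : ℝ := min (1 / 8) (min (κ / 8) (ρ * κ / 16)) with hδdef
  have hδ : 0 < δ := by positivity
  have hδ1 : δ ≤ 1 / 8 := min_le_left _ _
  have hδ2 : δ ≤ κ / 8 := (min_le_right _ _).trans (min_le_left _ _)
  have hδ3 : δ ≤ ρ * κ / 16 := (min_le_right _ _).trans (min_le_right _ _)
  set η : ℝ := min 1 (ρ / 2) with hηdef
  have hη : 0 < η := by positivity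
  have hη1 : η ≤ 1 := min_le_left _ _
  have hη2 : η ≤ ρ / 2 := min_le_right _ _
  have hlog : Tendsto (fun N : ℕ => Real.log N) atTop atTop :=
    Real.tendsto_log_atTop.comp tendsto_natCast_atTop_atTop
  filter_upwards [h.abs_sum_cappedObservable_sub_le hα hδ hδ1, eventually_ge_atTop 1,
    hlog.eventually_ge_atTop 1, hlog.eventually_ge_atTop (-Real.log η / δ)] with N hcap hN hL hL'
  have hN1 : (1 : ℝ) ≤ N := by exact_mod_cast hN
  have hN0 : (0 : ℝ) < N := by linarith
  set θ : ℝ := (N : ℝ) ^ (3 * δ - 1) with hθ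
  have hθ0 : 0 < θ := by positivity
  have hθ1 : θ ≤ 1 := Real.rpow_le_one_of_one_le_of_nonpos hN1 (by linarith)
  have hηN : 0 < η / N := by positivity
  have hηθ : η / N ≤ θ := by
    rw [div_le_iff₀ hN0]
    calc η ≤ 1 := hη1
      _ ≤ (N : ℝ) ^ (3 * δ) := Real.one_le_rpow hN1 (by linarith)
      _ = (N : ℝ) ^ (3 * δ - 1) * N := by
        rw [Real.rpow_sub hN0, Real.rpow_one]
        field_simp
  set L := Real.log N with hLdef
  have hNL : 0 < N * L := by positivity
  set M : ℝ := κ / 2 * (N * L) with hM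
  have hM0 : 0 < M := by positivity
  set Z : Set ℝ := ⋃ n ∈ Finset.range N, {x : ℝ | Int.fract (x + n * α) < η / N} with hZ
  set W : Set ℝ := {x : ℝ | M < ∑ n ∈ Finset.range N,
    windowObservable (η / N) θ (Int.fract (x + n * α))} with hW
  have hsub : {x : ℝ | x ∈ Set.Ico (0 : ℝ) 1 ∧ κ < |ergodicSum α N x / (N * L) - 1|} ⊆
      (Z ∪ W) ∩ Set.Ico 0 1 := by
    rintro x ⟨hx, hxκ⟩
    refine ⟨?_, hx⟩
    by_contra hc
    rw [Set.mem_union, not_or] at hc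
    obtain ⟨hcZ, hcW⟩ := hc
    simp only [hZ, Set.mem_iUnion, Set.mem_ofPred_eq, not_exists, not_lt] at hcZ
    simp only [hW, Set.mem_ofPred_eq, not_lt] at hcW
    have hlo : ∑ n ∈ Finset.range N, cappedObservable θ (Int.fract (x + n * α)) ≤
        ergodicSum α N x := by
      rw [ergodicSum_eq hx]
      exact Finset.sum_le_sum fun n hn => cappedObservable_le_one_div (hηN.trans_le (hcZ n hn))
    have hup : ergodicSum α N x ≤
        ∑ n ∈ Finset.range N, cappedObservable θ (Int.fract (x + n * α)) +
        ∑ n ∈ Finset.range N, windowObservable (η / N) θ (Int.fract (x + n * α)) := by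
      rw [ergodicSum_eq hx, ← Finset.sum_add_distrib]
      exact Finset.sum_le_sum fun n hn => one_div_le_cappedObservable_add hηN hθ0 (hcZ n hn)
    have hk := abs_le.1 (hcap x)
    have hδκ : 4 * δ * (N * L) ≤ κ / 2 * (N * L) := by gcongr; linarith
    rw [div_sub_one hNL.ne', abs_div, abs_of_pos hNL, lt_div_iff₀ hNL] at hxκ
    refine absurd hxκ (not_lt.2 (abs_le.2 ⟨?_, ?_⟩))
    · linarith [hk.1]
    · linarith [hk.2]
  have hZm : (volume.restrict (Set.Ico 0 1)) Z ≤ ENNReal.ofReal η := by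
    calc _ ≤ ∑ n ∈ Finset.range N,
          (volume.restrict (Set.Ico 0 1)) {x : ℝ | Int.fract (x + n * α) < η / N} :=
          measure_biUnion_finset_le _ _
      _ = ∑ n ∈ Finset.range N, ENNReal.ofReal (η / N) :=
          Finset.sum_congr rfl fun n _ => measure_fract_add_lt _ (hηθ.trans hθ1)
      _ = ENNReal.ofReal η := by
          rw [Finset.sum_const, Finset.card_range, nsmul_eq_mul, ← ENNReal.ofReal_natCast,
            ← ENNReal.ofReal_mul hN0.le, mul_div_cancel₀ _ hN0.ne']
  have hWm : (volume.restrict (Set.Ico 0 1)) W ≤ ENNReal.ofReal (ρ / 2) := by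
    refine (measure_sum_windowObservable_gt_le hηN hηθ hθ1 hM0 (fun n => n * α) N).trans
      (ENNReal.ofReal_le_ofReal ?_)
    have h1 : Real.log (θ / (η / N)) ≤ 4 * δ * L := by
      rw [Real.log_div hθ0.ne' hηN.ne', Real.log_div hη.ne' hN0.ne', Real.log_rpow hN0]
      rw [div_le_iff₀ hδ] at hL'
      linarith
    rw [div_le_iff₀ hM0]
    calc N * Real.log (θ / (η / N)) ≤ N * (4 * δ * L) := by gcongr
      _ = 4 * δ * (N * L) := by ring
      _ ≤ 4 * (ρ * κ / 16) * (N * L) := by gcongr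
      _ = ρ / 2 * M := by rw [hM]; ring
  calc _ ≤ volume ((Z ∪ W) ∩ Set.Ico 0 1) := measure_mono hsub
    _ = (volume.restrict (Set.Ico 0 1)) (Z ∪ W) := (Measure.restrict_apply' measurableSet_Ico).symm
    _ ≤ _ := measure_union_le _ _
    _ ≤ ENNReal.ofReal η + ENNReal.ofReal (ρ / 2) := add_le_add hZm hWm
    _ = ENNReal.ofReal (η + ρ / 2) := (ENNReal.ofReal_add hη.le (by positivity)).symm
    _ ≤ ENNReal.ofReal ρ := ENNReal.ofReal_le_ofReal (by linarith)

/-! ### Orbit clusters around a very good approximation -/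

theorem fract_add_int_eq {u w : ℝ} {k : ℤ} (h : u = w + k) (h0 : 0 ≤ w) (h1 : w < 1) :
    Int.fract u = w := by
  rw [h, Int.fract_add_intCast]
  exact Int.fract_eq_self.2 ⟨h0, h1⟩

/-- If the first `2 M` returns after time `q` drift by at most `M |q α - p|` from the central one,
then a close visit to `0` is recorded at the central time. -/
theorem le_fract_orbit_of_center {α s : ℝ} {p : ℤ} {q M : ℕ} (hq : 0 < q)
    (hs : s + 2 * M * |q * α - p| < 1) {x : ℝ}
    (hx : ∀ i < q, s + 2 * M * |q * α - p| ≤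
      Int.fract (x + ((i + M * q : ℕ) * α + M * |q * α - p|)))
    {n : ℕ} (hn : n < 2 * M * q) : s ≤ Int.fract (x + n * α) := by
  by_contra hc
  push Not at hc
  have hn' : n % q + q * (n / q) = n := Nat.mod_add_div n q
  have hj : n / q < 2 * M := (Nat.div_lt_iff_lt_mul hq).2 hn
  have hi : n % q < q := Nat.mod_lt n hq
  set i := n % q
  set j := n / q
  set β : ℝ := q * α - p with hβ
  have hj' : (j : ℝ) ≤ 2 * M := by exact_mod_cast hj.le
  have hj0 : (0 : ℝ) ≤ j := Nat.cast_nonneg j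
  have hw : |((M : ℝ) - j) * β| ≤ M * |β| := by
    rw [abs_mul]
    have : |(M : ℝ) - j| ≤ M := abs_le.2 ⟨by linarith, by linarith⟩
    gcongr
  have hw' := abs_le.1 hw
  have h0 := Int.fract_nonneg (x + n * α)
  have hnr : (n : ℝ) = i + q * j := by exact_mod_cast hn'.symm
  -- The times `n = i + j q` and `i + M q` differ by a drift `(M - j) β` of modulus at most `M |β|`;
  -- the extra shift `M |β|` makes it nonnegative, so no wrapping occurs.
  have := fract_add_int_eq
    (u := x + ((i + M * q : ℕ) * α + M * |β|))
    (w := Int.fract (x + n * α) + ((M - j) * β + M * |β|))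
    (k := ⌊x + n * α⌋ + (M - j) * p) (by
      have := Int.floor_add_fract (x + n * α)
      push_cast
      rw [hβ]
      rw [← eq_sub_iff_add_eq'] at this
      rw [this, hnr]
      ring) (by linarith) (by linarith)
  have h2 := hx i hi
  rw [this] at h2
  linarith

/-- The right side is the harmonic sum without its first term. At `M = 0` the bound relies on
`Real.log 0 = 0`. -/
theorem log_sub_one_le_sum (M : ℕ) :
    Real.log M - 1 ≤ ∑ k ∈ Finset.range (M - 1), 1 / ((k : ℝ) + 2) := by
  rcases M with - | M
  · simp
  have h := log_add_one_le_harmonic (M + 1)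
  rw [harmonic, Finset.sum_range_succ'] at h
  push_cast at h
  have h1 : Real.log ((M + 1 : ℕ) : ℝ) ≤ Real.log ((M : ℝ) + 1 + 1) := by
    push_cast
    exact Real.log_le_log (by positivity) (by linarith)
  have h2 : ∑ k ∈ Finset.range M, 1 / ((k : ℝ) + 2) =
      ∑ k ∈ Finset.range M, ((k : ℝ) + 1 + 1)⁻¹ :=
    Finset.sum_congr rfl fun k _ => by rw [one_div]; congr 1; ring
  rw [Nat.add_sub_cancel, h2]
  norm_num at h
  linarith

/-- A close visit to `0` at the central time produces a large ergodic sum. -/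
theorem le_sum_of_center_visit {α : ℝ} {p : ℤ} {q M : ℕ} (hβ : 0 < |q * α - p|)
    (hM1 : 2 * M * |q * α - p| < 1) {x : ℝ} {i : ℕ} (hi : i < q)
    (hx : Int.fract (x + (i + M * q : ℕ) * α) < M * |q * α - p|) :
    (Real.log M - 1) / |q * α - p| ≤
      ∑ n ∈ Finset.range (2 * M * q), 1 / Int.fract (x + n * α) := by
  set β : ℝ := q * α - p with hβdef
  set r := |β| with hr
  set s := Int.fract (x + (i + M * q : ℕ) * α) with hs
  have hs0 : 0 ≤ s := Int.fract_nonneg _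
  set t := ⌊s / r⌋₊ with ht
  have ht1 : (t : ℝ) * r ≤ s := by
    rw [← le_div_iff₀ hβ]
    exact Nat.floor_le (by positivity)
  have ht2 : s < (t + 1) * r := by
    rw [← div_lt_iff₀ hβ]
    exact Nat.lt_floor_add_one _
  have htM : t < M := by
    rw [ht, Nat.floor_lt (by positivity), div_lt_iff₀ hβ]
    exact hx
  -- The central point `s` lies in `[t r, (t + 1) r)`. The block `j k` moves it by `k + 1 - t` steps
  -- into `[(k + 1) r, (k + 2) r)`; the sign of `β` decides whether the blocks run forward or
  -- backward in time.
  obtain ⟨j, hj2, hjinj, hjβ⟩ : ∃ j : ℕ → ℕ, (∀ k < M - 1, j k < 2 * M) ∧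
      Set.InjOn j (Finset.range (M - 1)) ∧
      ∀ k < M - 1, ((j k : ℝ) - M) * β = (k + 1 - t) * r := by
    rcases le_total 0 β with h | h
    · refine ⟨fun k => M + k + 1 - t, fun k hk => by simp only; omega, fun a ha b hb hab => ?_,
        fun k hk => ?_⟩
      · simp only [Finset.coe_range, Set.mem_Iio] at ha hb hab
        omega
      · simp only
        rw [Nat.cast_sub (by omega), hr, abs_of_nonneg h]
        push_cast
        ring
    · refine ⟨fun k => M + t - (k + 1), fun k hk => by simp only; omega,
        fun a ha b hb hab => ?_, fun k hk => ?_⟩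
      · simp only [Finset.coe_range, Set.mem_Iio] at ha hb hab
        omega
      · simp only
        rw [Nat.cast_sub (by omega), hr, abs_of_nonpos h]
        push_cast
        ring
  have hpt : ∀ k ∈ Finset.range (M - 1), 1 / ((k : ℝ) + 2) / r ≤
      1 / Int.fract (x + (i + j k * q : ℕ) * α) := by
    intro k hk
    rw [Finset.mem_range] at hk
    have hkM : (k : ℝ) + 2 ≤ M := by
      have : k + 2 ≤ M := by omega
      exact_mod_cast this
    have hk0 : (0 : ℝ) ≤ k := Nat.cast_nonneg k
    have hw : (k + 2) * r ≤ M * r := by gcongr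
    have hkr : 0 ≤ (k : ℝ) * r := by positivity
    have := fract_add_int_eq (u := x + (i + j k * q : ℕ) * α) (w := s + (k + 1 - t) * r)
      (k := ⌊x + (i + M * q : ℕ) * α⌋ + (j k - M) * p) (by
        have := Int.floor_add_fract (x + (i + M * q : ℕ) * α)
        rw [← eq_sub_iff_add_eq'] at this
        rw [← hjβ k hk, hs, hβdef, this]
        push_cast
        ring) (by linarith) (by linarith)
    rw [this, div_div]
    exact one_div_le_one_div_of_le (by linarith) (by linarith)
  have hinj : Set.InjOn (fun k => i + j k * q) (Finset.range (M - 1)) := by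
    intro a ha b hb hab
    refine hjinj ha hb (Nat.eq_of_mul_eq_mul_right (Nat.zero_lt_of_lt hi) ?_)
    simp only at hab
    omega
  calc (Real.log M - 1) / r ≤ (∑ k ∈ Finset.range (M - 1), 1 / ((k : ℝ) + 2)) / r := by
        gcongr
        exact log_sub_one_le_sum M
    _ = ∑ k ∈ Finset.range (M - 1), 1 / ((k : ℝ) + 2) / r := Finset.sum_div _ _ _
    _ ≤ ∑ k ∈ Finset.range (M - 1), 1 / Int.fract (x + (i + j k * q : ℕ) * α) :=
        Finset.sum_le_sum hpt
    _ = ∑ n ∈ (Finset.range (M - 1)).image fun k => i + j k * q, 1 / Int.fract (x + n * α) :=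
        (Finset.sum_image (f := fun n : ℕ => 1 / Int.fract (x + n * α)) hinj).symm
    _ ≤ _ := by
        refine Finset.sum_le_sum_of_subset_of_nonneg ?_ fun n _ _ =>
          one_div_nonneg.2 (Int.fract_nonneg _)
        intro n hn
        obtain ⟨k, hk, rfl⟩ := Finset.mem_image.1 hn
        rw [Finset.mem_range] at hk ⊢
        have := hj2 k hk
        nlinarith

/-- Close visits to `0` at different central times do not happen together. -/
theorem center_visit_unique {α : ℝ} {p : ℤ} {q M : ℕ} (hq : 0 < q) (hpq : IsCoprime p (q : ℤ))
    (hM : 1 ≤ M) (hM1 : q * (2 * M * |q * α - p|) < 1) {x : ℝ} {i j : ℕ} (hi : i < q) (hj : j < q)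
    (hxi : Int.fract (x + (i + M * q : ℕ) * α) < M * |q * α - p|)
    (hxj : Int.fract (x + (j + M * q : ℕ) * α) < M * |q * α - p|) : i = j := by
  have hq' : (0 : ℝ) < q := by exact_mod_cast hq
  have hM' : (1 : ℝ) ≤ M := by exact_mod_cast hM
  have hi0 := Int.fract_nonneg (x + (i + M * q : ℕ) * α)
  have hj0 := Int.fract_nonneg (x + (j + M * q : ℕ) * α)
  have hif := Int.floor_add_fract (x + (i + M * q : ℕ) * α)
  have hjf := Int.floor_add_fract (x + (j + M * q : ℕ) * α)
  set k := ⌊x + (i + M * q : ℕ) * α⌋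
  set l := ⌊x + (j + M * q : ℕ) * α⌋
  set s := Int.fract (x + (i + M * q : ℕ) * α)
  set s' := Int.fract (x + (j + M * q : ℕ) * α)
  -- Eliminating `x` from the two visits leaves an integer of modulus less than 1, hence zero; so
  -- `q` divides `(i - j) p`.
  have hz : ((((i : ℤ) - j) * p - q * (k - l) : ℤ) : ℝ) =
      q * (s - s') - (i - j) * (q * α - p) := by
    push_cast at hif hjf ⊢
    linear_combination (q : ℝ) * (hjf - hif)
  have hr0 : 0 ≤ |q * α - p| := abs_nonneg _
  have b1 : |(q : ℝ) * (s - s')| ≤ q * (M * |q * α - p|) := by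
    rw [abs_mul, Nat.abs_cast]
    have : |s - s'| ≤ M * |q * α - p| := abs_le.2 ⟨by linarith, by linarith⟩
    gcongr
  have b2 : |((i : ℝ) - j) * (q * α - p)| ≤ q * (M * |q * α - p|) := by
    rw [abs_mul]
    have hi' : (i : ℝ) < q := by exact_mod_cast hi
    have hj' : (j : ℝ) < q := by exact_mod_cast hj
    have hi0' : (0 : ℝ) ≤ i := Nat.cast_nonneg i
    have hj0' : (0 : ℝ) ≤ j := Nat.cast_nonneg j
    have h1 : |(i : ℝ) - j| ≤ q := abs_le.2 ⟨by linarith, by linarith⟩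
    have h2 : |q * α - p| ≤ M * |q * α - p| := le_mul_of_one_le_left hr0 hM'
    gcongr
  have hlt : |((((i : ℤ) - j) * p - q * (k - l) : ℤ) : ℝ)| < 1 := by
    rw [hz]
    have := abs_sub (q * (s - s')) (((i : ℝ) - j) * (q * α - p))
    linarith
  have hzero : ((i : ℤ) - j) * p - q * (k - l) = 0 := by
    rw [← Int.abs_lt_one_iff]
    exact_mod_cast hlt
  have hdvd : (q : ℤ) ∣ ((i : ℤ) - j) * p := ⟨k - l, by linarith⟩
  have h6 : (i : ℤ) - j = 0 := by
    refine Int.eq_zero_of_abs_lt_dvd (hpq.symm.dvd_of_dvd_mul_right hdvd) ?_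
    rw [abs_lt]
    omega
  omega

theorem measure_center_visit {α : ℝ} {p : ℤ} {q M : ℕ} (hq : 0 < q) (hpq : IsCoprime p (q : ℤ))
    (hM : 1 ≤ M) (hM1 : q * (2 * M * |q * α - p|) < 1) :
    (volume.restrict (Set.Ico 0 1)) (⋃ i ∈ Finset.range q,
      {x : ℝ | Int.fract (x + (i + M * q : ℕ) * α) < M * |q * α - p|}) =
      ENNReal.ofReal (q * (M * |q * α - p|)) := by
  have hq1 : (1 : ℝ) ≤ q := by exact_mod_cast hq
  have hr0 : 0 ≤ M * |q * α - p| := by positivity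
  rw [measure_biUnion_finset]
  · rw [Finset.sum_congr rfl fun i _ => measure_fract_add_lt _ (by nlinarith), Finset.sum_const,
      Finset.card_range, nsmul_eq_mul, ← ENNReal.ofReal_natCast,
      ← ENNReal.ofReal_mul (Nat.cast_nonneg q)]
  · intro i hi j hj hij
    rw [Finset.coe_range, Set.mem_Iio] at hi hj
    refine Set.disjoint_left.2 fun x hxi hxj => hij ?_
    exact center_visit_unique hq hpq hM hM1 hi hj hxi hxj
  · intro i _
    exact measurableSet_lt (measurable_id.add_const _).fract measurable_const

/-- At the times `2 M q` the ergodic sums are `O(N log q)` on a set of measure at least `1 / 2`. -/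
theorem measure_sum_gt_le {α : ℝ} {p : ℤ} {q M : ℕ} (hq : 0 < q) (hM : 1 ≤ M)
    (hM1 : q * (2 * M * |q * α - p|) ≤ 1 / 8) :
    (volume.restrict (Set.Ico 0 1)) {x : ℝ | 4 * ((2 * M * q : ℕ) * Real.log (8 * q)) <
      ∑ n ∈ Finset.range (2 * M * q), 1 / Int.fract (x + n * α)} ≤ ENNReal.ofReal (1 / 2) := by
  have hq1 : (1 : ℝ) ≤ q := by exact_mod_cast hq
  have hq0 : (0 : ℝ) < q := by linarith
  set r := |q * α - p| with hr
  have hr0 : 0 ≤ 2 * M * r := by positivity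
  -- Only the `q` central times enter the union bound, at cost `q (s + 2 M r) ≤ 1 / 4`. Off `Z`
  -- every orbit point is at least `s`, so the sum equals its truncation, of mean `N log (8 q)`;
  -- Markov at four times the mean costs another `1 / 4`.
  set s : ℝ := 1 / (8 * q) with hs
  have hs0 : 0 < s := by positivity
  have hqs : q * s = 1 / 8 := by rw [hs]; field_simp
  have hsr : s + 2 * M * r < 1 := by nlinarith
  set N := 2 * M * q with hN
  have hlog : 0 < Real.log (8 * q) := Real.log_pos (by linarith)
  have hN0 : (0 : ℝ) < N := by
    have : 0 < N := by positivity
    exact_mod_cast this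
  set K : ℝ := 4 * (N * Real.log (8 * q)) with hK
  have hK0 : 0 < K := by positivity
  set Z : Set ℝ := ⋃ i ∈ Finset.range q,
    {x : ℝ | Int.fract (x + ((i + M * q : ℕ) * α + M * r)) < s + 2 * M * r} with hZ
  set W : Set ℝ := {x : ℝ | K < ∑ n ∈ Finset.range N,
    windowObservable s 1 (Int.fract (x + n * α))} with hW
  have hsub : {x : ℝ | K < ∑ n ∈ Finset.range N, 1 / Int.fract (x + n * α)} ⊆ Z ∪ W := by
    intro x hx
    rw [Set.mem_union]
    by_contra! hc
    obtain ⟨hcZ, hcW⟩ := hc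
    simp only [hZ, Set.mem_iUnion, Set.mem_ofPred_eq, not_exists, not_lt, Finset.mem_range] at hcZ
    refine hcW ?_
    rw [Set.mem_ofPred_eq] at hx
    rw [hW, Set.mem_ofPred_eq]
    convert hx using 1
    refine Finset.sum_congr rfl fun n hn => ?_
    rw [windowObservable, Set.indicator_of_mem]
    exact ⟨le_fract_orbit_of_center hq hsr hcZ (Finset.mem_range.1 hn), Int.fract_lt_one _⟩
  have hZm : (volume.restrict (Set.Ico 0 1)) Z ≤ ENNReal.ofReal (1 / 4) := by
    calc _ ≤ ∑ i ∈ Finset.range q, (volume.restrict (Set.Ico 0 1))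
          {x : ℝ | Int.fract (x + ((i + M * q : ℕ) * α + M * r)) < s + 2 * M * r} :=
          measure_biUnion_finset_le _ _
      _ = ∑ i ∈ Finset.range q, ENNReal.ofReal (s + 2 * M * r) :=
          Finset.sum_congr rfl fun n _ => measure_fract_add_lt _ hsr.le
      _ = ENNReal.ofReal (q * (s + 2 * M * r)) := by
          rw [Finset.sum_const, Finset.card_range, nsmul_eq_mul, ← ENNReal.ofReal_natCast,
            ← ENNReal.ofReal_mul hq0.le]
      _ ≤ ENNReal.ofReal (1 / 4) := ENNReal.ofReal_le_ofReal (by linarith)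
  have hWm : (volume.restrict (Set.Ico 0 1)) W ≤ ENNReal.ofReal (1 / 4) := by
    refine (measure_sum_windowObservable_gt_le hs0 ?_ le_rfl hK0 (fun n => n * α) N).trans
      (ENNReal.ofReal_le_ofReal ?_)
    · nlinarith
    · rw [hs, one_div_one_div, div_le_iff₀ hK0, hK]
      linarith
  calc _ ≤ (volume.restrict (Set.Ico 0 1)) (Z ∪ W) := measure_mono hsub
    _ ≤ _ := measure_union_le _ _
    _ ≤ ENNReal.ofReal (1 / 4) + ENNReal.ofReal (1 / 4) := add_le_add hZm hWm
    _ = ENNReal.ofReal (1 / 2) := by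
      rw [← ENNReal.ofReal_add (by norm_num) (by norm_num)]
      norm_num

/-! ### Necessity of Roth type and uniqueness of the normalisation -/

theorem exists_mem_of_measure_lt {s t : Set ℝ}
    (h : (volume.restrict (Set.Ico (0 : ℝ) 1)) s < (volume.restrict (Set.Ico (0 : ℝ) 1)) t) :
    ∃ x ∈ Set.Ico (0 : ℝ) 1, x ∈ t ∧ x ∉ s := by
  by_contra! hc
  refine absurd h (not_lt.2 ?_)
  rw [Measure.restrict_apply' measurableSet_Ico, Measure.restrict_apply' measurableSet_Ico]
  exact measure_mono fun x hx => ⟨hc x hx.2 hx.1, hx.2⟩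

theorem WeakLaw.tendsto_restrict {α : ℝ} {d : ℕ → ℝ} (h : WeakLaw α d) {ε : ℝ} (hε : 0 < ε) :
    Tendsto (fun N : ℕ => (volume.restrict (Set.Ico (0 : ℝ) 1))
      {x : ℝ | ε < |ergodicSum α N x / d N - 1|}) atTop (𝓝 0) := by
  refine (h ε hε).congr fun N => ?_
  rw [Measure.restrict_apply' measurableSet_Ico]
  congr 1
  ext x
  exact and_comm

theorem measure_restrict_univ :
    (volume.restrict (Set.Ico (0 : ℝ) 1)) Set.univ = 1 := by
  rw [Measure.restrict_apply_univ, Real.volume_Ico]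
  simp

theorem WeakLaw.isRothType {α : ℝ} (hα : Irrational α) {d : ℕ → ℝ}
    (hd : ∀ N : ℕ, 1 ≤ N → 0 < d N) (h : WeakLaw α d) : IsRothType α := by
  by_contra hR
  obtain ⟨ε, hε, hbad⟩ := exists_good_approx_of_not_isRothType hα hR
  -- `1 / 8` meets the hypothesis of `measure_sum_gt_le`; `ε / 64` turns `(ε / 2) log q / r` into
  -- `32 N log q`, using `N r ≤ c`.
  set c : ℝ := min (1 / 8) (ε / 64) with hcdef
  have hc0 : 0 < c := by positivity
  have hc1 : c ≤ 1 / 8 := min_le_left _ _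
  have hc2 : c ≤ ε / 64 := min_le_right _ _
  have hev : ∀ᶠ N : ℕ in atTop, (volume.restrict (Set.Ico (0 : ℝ) 1))
      {x : ℝ | 1 / 2 < |ergodicSum α N x / d N - 1|} < ENNReal.ofReal (c / 4) :=
    (h.tendsto_restrict (by norm_num)).eventually_lt_const (by simpa using hc0)
  obtain ⟨N₀, hN₀⟩ := eventually_atTop.1 hev
  have hpow : ∀ᶠ y : ℝ in atTop, 4 / c ≤ y ^ ε :=
    (tendsto_rpow_atTop hε).eventually_ge_atTop _
  have hlog : ∀ᶠ y : ℝ in atTop, (1 - Real.log (c / 4)) / (ε / 2) ≤ Real.log y :=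
    Real.tendsto_log_atTop.eventually_ge_atTop _
  obtain ⟨Q, hQ⟩ := eventually_atTop.1 (hpow.and (hlog.and
    ((eventually_ge_atTop (8 : ℝ)).and (eventually_ge_atTop (N₀ : ℝ)))))
  obtain ⟨p, q, hqQ, hq, hpq, hr0, hr⟩ := hbad Q
  obtain ⟨hqpow, hqlog, hq8, hqN₀⟩ := hQ q hqQ
  set r := |q * α - p| with hrdef
  have hq0 : (0 : ℝ) < q := by linarith
  have hqr : (q : ℝ) ^ ε * (q * r) ≤ 1 := by
    rw [le_div_iff₀ (by positivity), Real.rpow_add hq0, Real.rpow_one] at hr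
    linarith
  have hy : c * (q : ℝ) ^ ε / 2 ≤ c / (2 * q * r) := by
    rw [div_le_div_iff₀ (by norm_num) (by positivity)]
    nlinarith
  -- The largest `M` with `2 M q r ≤ c`. The quotient is at least 2, so rounding down loses at most
  -- a factor 2 and `q M r ≥ c / 4`.
  set M := ⌊c / (2 * q * r)⌋₊ with hMdef
  have hM1 : (M : ℝ) ≤ c / (2 * q * r) := Nat.floor_le (by positivity)
  have hM2 : c / (2 * q * r) < M + 1 := Nat.lt_floor_add_one _
  have hcq : 4 ≤ c * (q : ℝ) ^ ε := by
    rw [div_le_iff₀ hc0] at hqpow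
    linarith
  have hM3 : c / (2 * q * r) / 2 ≤ M := by linarith
  have hMpos : 1 ≤ M := by
    have : (1 : ℝ) ≤ M := by linarith
    exact_mod_cast this
  have hMq : q * (2 * M * r) ≤ c := by
    rw [le_div_iff₀ (by positivity)] at hM1
    linarith
  have hMq' : c / 4 ≤ q * (M * r) := by
    rw [div_div, div_le_iff₀ (by positivity)] at hM3
    linarith
  set L := Real.log q with hLdef
  have hL0 : 0 < L := Real.log_pos (by linarith)
  set N := 2 * M * q with hN
  have hNr : (N : ℝ) = 2 * M * q := by rw [hN]; push_cast; ring
  have hNq : q ≤ N := by nlinarith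
  have hN1 : 1 ≤ N := by omega
  have hN0 : (0 : ℝ) < N := by exact_mod_cast hN1
  have hV := hN₀ N (le_trans (by exact_mod_cast hqN₀) hNq)
  have hdN := hd N hN1
  have hmid : ∀ x, x ∉ {x : ℝ | 1 / 2 < |ergodicSum α N x / d N - 1|} →
      d N / 2 ≤ ergodicSum α N x ∧ ergodicSum α N x ≤ 3 / 2 * d N := by
    intro x hx
    rw [Set.mem_ofPred_eq, not_lt, abs_le] at hx
    have h1 : 1 / 2 ≤ ergodicSum α N x / d N := by linarith [hx.1]
    have h2 : ergodicSum α N x / d N ≤ 3 / 2 := by linarith [hx.2]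
    rw [le_div_iff₀ hdN] at h1
    rw [div_le_iff₀ hdN] at h2
    constructor <;> linarith
  -- a point with a moderate ergodic sum
  obtain ⟨x, hx, -, hxn⟩ := exists_mem_of_measure_lt (t := Set.univ)
    (s := {x : ℝ | 1 / 2 < |ergodicSum α N x / d N - 1|} ∪
      {x : ℝ | 4 * (N * Real.log (8 * q)) < ∑ n ∈ Finset.range N, 1 / Int.fract (x + n * α)}) (by
      refine (measure_union_le _ _).trans_lt ?_
      have hle := measure_sum_gt_le hq hMpos (hMq.trans hc1)
      refine (ENNReal.add_lt_add_of_lt_of_le (ne_top_of_le_ne_top ENNReal.ofReal_ne_top hle) hV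
        hle).trans_le ?_
      rw [measure_restrict_univ, ← ENNReal.ofReal_add (by positivity) (by norm_num)]
      exact ENNReal.ofReal_le_one.2 (by linarith))
  rw [Set.mem_union, not_or] at hxn
  have hx1 := (hmid x hxn.1).1
  have hx2 := hxn.2
  rw [Set.mem_ofPred_eq, not_lt, ← ergodicSum_eq hx] at hx2
  have hlog8 : Real.log (8 * q) ≤ 2 * L := by
    rw [Real.log_mul (by norm_num) hq0.ne']
    have : Real.log 8 ≤ Real.log q := Real.log_le_log (by norm_num) hq8
    linarith
  have hx3 : ergodicSum α N x ≤ 8 * (N * L) := by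
    have : N * Real.log (8 * q) ≤ N * (2 * L) := by gcongr
    linarith
  -- a point with a large ergodic sum
  obtain ⟨y, hy, hyB, hyn⟩ := exists_mem_of_measure_lt
    (s := {x : ℝ | 1 / 2 < |ergodicSum α N x / d N - 1|})
    (t := ⋃ i ∈ Finset.range q, {x : ℝ | Int.fract (x + (i + M * q : ℕ) * α) < M * r}) (by
      rw [measure_center_visit hq hpq hMpos (by linarith)]
      exact hV.trans_le (ENNReal.ofReal_le_ofReal hMq'))
  have hy1 := (hmid y hyn).2
  simp only [Set.mem_iUnion, Finset.mem_range, Set.mem_ofPred_eq] at hyB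
  obtain ⟨i, hi, hyi⟩ := hyB
  have hMr : 2 * M * r < 1 := by
    have : 0 ≤ 2 * M * r := by positivity
    nlinarith
  have hy2 := le_sum_of_center_visit hr0 hMr hi hyi
  rw [← ergodicSum_eq hy] at hy2
  have hlogM : ε / 2 * L ≤ Real.log M - 1 := by
    have h1 : c / 4 * (q : ℝ) ^ ε ≤ M := by linarith
    have h2 := Real.log_le_log (by positivity) h1
    rw [Real.log_mul (by positivity) (by positivity), Real.log_rpow hq0] at h2
    rw [div_le_iff₀ (by positivity)] at hqlog
    linarith
  have hy3 : 32 * (N * L) ≤ ergodicSum α N y := by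
    refine le_trans ?_ hy2
    rw [le_div_iff₀ hr0]
    refine le_trans ?_ hlogM
    have h1 : N * r ≤ c := by rw [hNr]; linarith
    calc 32 * (N * L) * r = 32 * L * (N * r) := by ring
      _ ≤ 32 * L * c := by gcongr
      _ ≤ 32 * L * (ε / 64) := by gcongr
      _ = ε / 2 * L := by ring
  have hNL : 0 < N * L := by positivity
  -- The two points give `d N ≤ 16 N L` and `d N ≥ (64 / 3) N L`.
  linarith

/-- Each law fails on a set of measure below `1 / 2`, so some point is good for both, and there the
same ergodic sum is close to `d N` and to `e N`. -/
theorem WeakLaw.tendsto_div {α : ℝ} {d e : ℕ → ℝ} (hd : ∀ᶠ N in atTop, 0 < d N)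
    (he : ∀ᶠ N in atTop, 0 < e N) (hWd : WeakLaw α d) (hWe : WeakLaw α e) :
    Tendsto (fun N => d N / e N) atTop (𝓝 1) := by
  rw [Metric.tendsto_nhds]
  intro ε hε
  set η : ℝ := min (1 / 2) (ε / 8) with hηdef
  have hη : 0 < η := by positivity
  have hη1 : η ≤ 1 / 2 := min_le_left _ _
  have hη2 : η ≤ ε / 8 := min_le_right _ _
  have hhalf : (0 : ENNReal) < ENNReal.ofReal (1 / 2) := by simp
  filter_upwards [hd, he, (hWd.tendsto_restrict hη).eventually_lt_const hhalf,
    (hWe.tendsto_restrict hη).eventually_lt_const hhalf] with N hdN heN h1 h2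
  obtain ⟨x, -, -, hx⟩ := exists_mem_of_measure_lt (t := Set.univ)
    (s := {x : ℝ | η < |ergodicSum α N x / d N - 1|} ∪
      {x : ℝ | η < |ergodicSum α N x / e N - 1|}) (by
      refine (measure_union_le _ _).trans_lt ((ENNReal.add_lt_add h1 h2).trans_le ?_)
      rw [measure_restrict_univ, ← ENNReal.ofReal_add (by norm_num) (by norm_num)]
      norm_num)
  rw [Set.mem_union, not_or, Set.mem_ofPred_eq, Set.mem_ofPred_eq, not_lt, not_lt] at hx
  obtain ⟨ha, hb⟩ := hx
  set a := ergodicSum α N x / d N with hadef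
  set b := ergodicSum α N x / e N with hbdef
  have hab : a * (d N / e N) = b := by
    rw [hadef, hbdef]
    field_simp
  rw [abs_le] at ha hb
  have ha0 : 1 / 2 ≤ a := by linarith
  rw [Real.dist_eq]
  have h3 : a * (d N / e N - 1) = b - a := by linarith
  have h4 : a * |d N / e N - 1| ≤ 2 * η := by
    rw [← abs_of_nonneg (show 0 ≤ a by linarith), ← abs_mul, h3]
    exact abs_le.2 ⟨by linarith, by linarith⟩
  have h5 := abs_nonneg (d N / e N - 1)
  nlinarith

end RotationWeakLaw

theorem mainTheorem3 (α : ℝ) (hα : Irrational α) (hα01 : α ∈ Set.Ioo (0 : ℝ) 1) :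
    ((∃ d : ℕ → ℝ, (∀ N : ℕ, 1 ≤ N → 0 < d N) ∧ RotationWeakLaw.WeakLaw α d) ↔
        RotationWeakLaw.IsRothType α) ∧
      (RotationWeakLaw.IsRothType α →
        RotationWeakLaw.WeakLaw α (fun N : ℕ => (N : ℝ) * Real.log (N : ℝ)) ∧
        ∀ d : ℕ → ℝ, (∀ N : ℕ, 1 ≤ N → 0 < d N) → RotationWeakLaw.WeakLaw α d →
          Tendsto (fun N : ℕ => d N / ((N : ℝ) * Real.log (N : ℝ))) atTop (𝓝 1)) := by
  have hpos : ∀ N : ℕ, 2 ≤ N → 0 < (N : ℝ) * Real.log (N : ℝ) := fun N hN => by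
    have : (2 : ℝ) ≤ N := by exact_mod_cast hN
    exact mul_pos (by linarith) (Real.log_pos (by linarith))
  refine ⟨⟨fun ⟨d, hd, h⟩ => h.isRothType hα hd, fun h => ?_⟩, fun h => ⟨h.weakLaw hα, ?_⟩⟩
  -- `N log N` vanishes at `N = 1`, where positivity is required, so small `N` get the value 1.
  · refine ⟨fun N => if 2 ≤ N then (N : ℝ) * Real.log (N : ℝ) else 1, fun N _ => ?_,
      fun ε hε => ?_⟩
    · simp only
      split_ifs with hN
      exacts [hpos N hN, one_pos]
    · refine (h.weakLaw hα ε hε).congr' ?_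
      filter_upwards [eventually_ge_atTop 2] with N hN
      simp only [if_pos hN]
  · intro d hd hWd
    exact RotationWeakLaw.WeakLaw.tendsto_div
      ((eventually_ge_atTop 1).mono hd) ((eventually_ge_atTop 2).mono hpos) hWd (h.weakLaw hα)
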